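/- All graphs and digraphs are finite and have at least one vertex. Digraphs have no loops and no parallel arcs, but may contain pairs of opposite arcs. A digraph $D$ contains a digraph $H$ if there is an injective map $V(H)\to V(D)$ that sends every arc of $H$ to an arc of $D$. An oriented tree (cycle) is a digraph obtained by choosing one direction for each edge of an undirected tree (of an undirected cycle of length at least $3$); an oriented cycle is directed if all its arcs go around in the same sense, and non-directed otherwise. An antidirected tree is an oriented tree without a directed path of length $2$. Let $\Delta(T)$ be the maximum degree of (the underlying graph of) $T$. The minimum pseudo-semidegree $\bar\delta^0(D)$ is $0$ if $D$ has no arcs, and otherwise it is the smaller one of the minimum positive out-degree and the minimum positive in-degree of $D$. **Theorem.** Let $k\ge 0$ and $\ell\ge 1$ be integers, let $T$ be an antidirected tree with $k$ edges, and let $D$ be a digraph with $\bar\delta^0(D)\ge\max\{k/\ell,\Delta(T)\}$. If $D$ contains no non-directed oriented cycle of length between $3$ and $2\ell$, then $D$ contains $T$. Consequently (Jiang's theorem), for all integers $k\ge 0$ and $\ell\ge 1$: if $G$ is an undirected simple graph of girth at least $2\ell+1$ (the girth of a forest being $\infty$), $T$ is an undirected tree with at most $k$ edges, and the minimum degree of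 $G$ is at least $\max\{k/\ell,\Delta(T)\}$, then $G$ contains $T$ as a subgraph. -/

import Mathlib

namespace Digraph

/-- `D` has no loops. (Parallel arcs are excluded by the type `Digraph`; a pair of opposite
arcs, i.e. a directed 2-cycle, is allowed.) -/
def IsLoopless {V : Type*} (D : Digraph V) : Prop :=
  ∀ v, ¬ D.Adj v v

/-- The out-degree of `v`. -/
noncomputable def outDeg {V : Type*} (D : Digraph V) (v : V) : ℕ :=
  {w | D.Adj v w}.ncard

/-- The in-degree of `v`. -/
noncomputable def inDeg {V : Type*} (D : Digraph V) (v : V) : ℕ :=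
  {w | D.Adj w v}.ncard

/-- The number of arcs of `D`. -/
noncomputable def numArcs {V : Type*} (D : Digraph V) : ℕ :=
  {e : V × V | D.Adj e.1 e.2}.ncard

open Classical in
/-- The minimum pseudo-semidegree: `0` if `D` has no arcs, and otherwise the smaller one of the
minimum positive out-degree and the minimum positive in-degree. (If a finite digraph has an
arc, then both sets below are nonempty.) -/
noncomputable def minPseudoSemidegree {V : Type*} (D : Digraph V) : ℕ :=
  if ∃ v w, D.Adj v w then
    min (sInf {d | 0 < d ∧ ∃ v, D.outDeg v = d}) (sInf {d | 0 < d ∧ ∃ v, D.inDeg v = d})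
  else 0

open Classical in
/-- The maximum degree of the underlying (simple, undirected) graph of `D`. -/
noncomputable def maxDeg {V : Type*} [Fintype V] (D : Digraph V) : ℕ :=
  D.toSimpleGraphInclusive.maxDegree

/-- `D` contains `H`: there is an injective map of the vertices that preserves arcs. -/
def Contains {V W : Type*} (D : Digraph V) (H : Digraph W) : Prop :=
  ∃ f : W → V, Function.Injective f ∧ ∀ a b, H.Adj a b → D.Adj (f a) (f b)

/-- An oriented graph is a digraph without loops and without directed 2-cycles. -/
def IsOriented {V : Type*} (D : Digraph V) : Prop :=
  D.IsLoopless ∧ ∀ v w, D.Adj v w → ¬ D.Adj w v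

/-- An oriented tree is an oriented graph whose underlying graph is a tree. -/
def IsOrientedTree {V : Type*} (T : Digraph V) : Prop :=
  T.IsOriented ∧ T.toSimpleGraphInclusive.IsTree

/-- An antidirected tree is an oriented tree without a directed path of length two. -/
def IsAntidirectedTree {V : Type*} (T : Digraph V) : Prop :=
  T.IsOrientedTree ∧
    ¬ ∃ a b c, a ≠ b ∧ b ≠ c ∧ a ≠ c ∧ T.Adj a b ∧ T.Adj b c

/-- The oriented cycle with vertices `0, 1, …, n - 1` (for `n ≥ 3`) in which the edge between `i`
and `i + 1` is the arc from `i` to `i + 1` if `ε i = true`, and the arc from `i + 1` to `i` if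
`ε i = false`. Up to isomorphism these are all the orientations of the cycle of length `n`. -/
def orientedCycle (n : ℕ) (ε : ZMod n → Bool) : Digraph (ZMod n) where
  Adj i j := (j = i + 1 ∧ ε i = true) ∨ (i = j + 1 ∧ ε j = false)

/-- `D` contains no non-directed oriented cycle of length between `3` and `m`. An oriented cycle
is directed if all of its arcs go around in the same sense. -/
def NonDirectedCycleFree {V : Type*} (D : Digraph V) (m : ℕ) : Prop :=
  ∀ (n : ℕ) (ε : ZMod n → Bool), 3 ≤ n → n ≤ m → ¬ (∀ i j, ε i = ε j) →
    ¬ D.Contains (orientedCycle n ε)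

end Digraph

/-! Every vertex of an antidirected tree `T` is a source or a sink (or isolated). So a homomorphism
from the underlying tree to the bipartite graph `splitGraph D` that puts sources and sinks on the
right sides, and stays injective after the projection `π` to the vertices of `D`, is a copy of `T`
in `D`. Without short non-directed cycles in `D`, no non-backtracking walk of length at most `2 * ℓ`
is closed modulo `π`. For Jiang's theorem the host is `G` and `π` is the identity. Both cases are
`IsTree.exists_hom_injective`.

Since degrees in the host are at least `δ ≥ Δ(T)`, locally injective homomorphisms exist and can be
rebuilt freely below any vertex. One is made injective modulo `π` on a growing set `S` of vertices,
taken by height. If the next vertex `v` cannot join, then every branch at the images of the nearest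
`ℓ` ancestors of `v` is occupied by `S`, since otherwise a subtree could move there
(`exists_used_of_no_relocation`). Short walks being open, the occupants are distinct: `ℓ * (δ - 1)`
of them, together with `ℓ + 1` vertices of a path, exceed the `ℓ * δ` vertices available to `S`
(`exists_injOn_insert`). -/

namespace SimpleGraph

/-! ### Non-backtracking walks -/

/-- `G.NBWalk a b c d n` says that `G` has a non-backtracking walk with `n` edges from `a` to `d`,
whose first edge is `ab` and whose last edge is `cd`. -/
inductive NBWalk {α : Type*} (G : SimpleGraph α) : α → α → α → α → ℕ → Prop
  | single {a b : α} : G.Adj a b → NBWalk G a b a b 1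
  | cons {a b c d e : α} {n : ℕ} : G.Adj a b → a ≠ c → NBWalk G b c d e n →
      NBWalk G a b d e (n + 1)

namespace NBWalk

variable {α : Type*} {G : SimpleGraph α} {a b c d e f g : α} {m n : ℕ}

theorem adj_left (h : G.NBWalk a b c d n) : G.Adj a b := by
  cases h <;> assumption

theorem pos (h : G.NBWalk a b c d n) : 1 ≤ n := by
  cases h <;> omega

/-- Backtracking can only arise at the junction, which is why the end edges are recorded. -/
theorem append (h : G.NBWalk a b c d m) (hne : c ≠ e) (h' : G.NBWalk d e f g n) :
    G.NBWalk a b f g (m + n) := by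
  induction h with
  | single hab => rw [add_comm]; exact cons hab hne h'
  | cons hab hac _ ih => rw [add_right_comm]; exact cons hab hac (ih hne h')

theorem concat (h : G.NBWalk a b c d n) (hne : c ≠ e) (hde : G.Adj d e) :
    G.NBWalk a b d e (n + 1) :=
  h.append hne (single hde)

theorem reverse (h : G.NBWalk a b c d n) : G.NBWalk d c b a n := by
  induction h with
  | single hab => exact single hab.symm
  | cons hab hac _ ih => exact ih.concat hac.symm hab.symm

theorem exists_fun (h : G.NBWalk a b c d n) :
    ∃ p : ℕ → α, p 0 = a ∧ p 1 = b ∧ p n = d ∧ (∀ i < n, G.Adj (p i) (p (i + 1))) ∧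
      ∀ i, i + 2 ≤ n → p i ≠ p (i + 2) := by
  induction h with
  | @single a b hab =>
    refine ⟨fun i => if i = 0 then a else b, by simp, by simp, by simp, ?_, fun i hi => by omega⟩
    intro i hi
    obtain rfl : i = 0 := by omega
    simpa using hab
  | @cons a b c d e n hab hac h ih =>
    obtain ⟨p, h0, h1, hn, hadj, hne⟩ := ih
    refine ⟨fun i => if i = 0 then a else p (i - 1), by simp, by simpa using h0, by simpa using hn,
      ?_, ?_⟩
    · rintro (_ | i) hi
      · simpa [h0] using hab
      · simpa using hadj i (by omega)
    · rintro (_ | i) hi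
      · simpa [h1] using hac
      · simpa using hne i (by omega)

theorem of_fun {p : ℕ → α} (hadj : ∀ i < n, G.Adj (p i) (p (i + 1)))
    (hne : ∀ i, i + 2 ≤ n → p i ≠ p (i + 2)) {i k : ℕ} (hk : i + (k + 1) ≤ n) :
    G.NBWalk (p i) (p (i + 1)) (p (i + k)) (p (i + (k + 1))) (k + 1) := by
  induction k with
  | zero => exact single (hadj i (by omega))
  | succ k ih =>
    exact (ih (by omega)).concat (hne (i + k) (by omega)) (hadj (i + (k + 1)) (by omega))

/-- The image of a non-backtracking walk under a locally injective homomorphism. -/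
theorem map {β : Type*} {H : SimpleGraph β} {φ : α → β}
    (hφ : ∀ x y, G.Adj x y → H.Adj (φ x) (φ y))
    (hinj : ∀ x y z, G.Adj x y → G.Adj x z → φ y = φ z → y = z)
    (h : G.NBWalk a b c d n) : H.NBWalk (φ a) (φ b) (φ c) (φ d) n := by
  induction h with
  | single hab => exact single (hφ _ _ hab)
  | cons hab hac h ih =>
    exact cons (hφ _ _ hab) (fun he => hac (hinj _ _ _ hab.symm h.adj_left he)) ih

end NBWalk

/-- A sequence that takes a value twice contains a minimal closed segment. -/
theorem exists_minimal_closed_segment {β : Type*} (q : ℕ → β) {n : ℕ} (hn : 1 ≤ n)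
    (h : q 0 = q n) :
    ∃ i m, 1 ≤ m ∧ i + m ≤ n ∧ q i = q (i + m) ∧
      ∀ s < m, ∀ t < m, q (i + s) = q (i + t) → s = t := by
  classical
  have hex : ∃ m, 1 ≤ m ∧ ∃ i, i + m ≤ n ∧ q i = q (i + m) := ⟨n, hn, 0, by simp, by simpa using h⟩
  obtain ⟨h1, i, hi, heq⟩ := Nat.find_spec hex
  refine ⟨i, Nat.find hex, h1, hi, heq, ?_⟩
  have key : ∀ s t, s < t → t < Nat.find hex → q (i + s) = q (i + t) → False := by
    intro s t hst ht hq
    refine Nat.find_min hex (m := t - s) (by omega) ⟨by omega, i + s, by omega, ?_⟩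
    rw [hq]; congr 1; omega
  intro s hs t ht hq
  rcases lt_trichotomy s t with hlt | rfl | hlt
  · exact (key s t hlt ht hq).elim
  · rfl
  · exact (key t s hlt hs hq.symm).elim

end SimpleGraph

/-! ### Rooted trees and locally injective homomorphisms -/

namespace SimpleGraph

variable {W α : Type*} {T : SimpleGraph W} {B : SimpleGraph α}

/-- `par` and `h` are the parent function and the height function of `T` with root `r`. -/
structure IsRooting (T : SimpleGraph W) (r : W) (h : W → ℕ) (par : W → W) : Prop where
  par_root : par r = r
  height_par : ∀ a, a ≠ r → h (par a) + 1 = h a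
  adj_par : ∀ a, a ≠ r → T.Adj a (par a)
  eq_par_or : ∀ a b, T.Adj a b → (a ≠ r ∧ b = par a) ∨ (b ≠ r ∧ a = par b)

/-- The parent is the next vertex on a geodesic to `r`; a second neighbour nearer to `r` would give
a second path from `r`. -/
theorem IsTree.exists_isRooting (hT : T.IsTree) (r : W) :
    ∃ par, T.IsRooting r (T.dist r) par := by
  classical
  have hex : ∀ a, ∃ b, a ≠ r → T.Adj a b ∧ T.dist r b + 1 = T.dist r a := by
    intro a
    by_cases ha : a = r
    · exact ⟨r, fun h => (h ha).elim⟩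
    · obtain ⟨p, hp, hlen⟩ := hT.connected.exists_path_of_dist a r
      cases p with
      | nil => exact (ha rfl).elim
      | @cons _ b _ hab q =>
        refine ⟨b, fun _ => ⟨hab, ?_⟩⟩
        have h1 : T.dist b r ≤ q.length := dist_le q
        rw [Walk.length_cons, dist_comm] at hlen
        rw [dist_comm] at h1
        rcases hT.dist_eq_dist_add_one_of_adj r hab with h2 | h2 <;> omega
  choose par hpar using hex
  have huniq : ∀ a b, T.Adj a b → T.dist r a = T.dist r b + 1 → a ≠ r ∧ b = par a := by
    intro a b hab hd
    have har : a ≠ r := by rintro rfl; simp at hd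
    refine ⟨har, ?_⟩
    obtain ⟨hadj, hd'⟩ := hpar a har
    obtain ⟨p, hp, hpl⟩ := hT.connected.exists_path_of_dist r b
    obtain ⟨q, hq, hql⟩ := hT.connected.exists_path_of_dist r (par a)
    have h1 : (p.concat hab.symm).IsPath :=
      Walk.isPath_of_length_eq_dist _ (by rw [Walk.length_concat]; omega)
    have h2 : (q.concat hadj.symm).IsPath :=
      Walk.isPath_of_length_eq_dist _ (by rw [Walk.length_concat]; omega)
    have := (hT.existsUnique_path r a).unique h1 h2
    have h3 := congrArg Walk.penultimate this
    simpa using h3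
  refine ⟨fun a => if a = r then r else par a, by simp, ?_, ?_, ?_⟩
  · intro a ha; simpa [ha] using (hpar a ha).2
  · intro a ha; simpa [ha] using (hpar a ha).1
  · intro a b hab
    rcases hT.dist_eq_dist_add_one_of_adj r hab with h | h
    · obtain ⟨h1, h2⟩ := huniq a b hab h
      exact Or.inl ⟨h1, by simpa [h1] using h2⟩
    · obtain ⟨h1, h2⟩ := huniq b a hab.symm h
      exact Or.inr ⟨h1, by simpa [h1] using h2⟩

/-- The geodesic between two vertices of a tree, as a sequence. -/
theorem IsTree.exists_geodesic (hT : T.IsTree) (a b : W) :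
    ∃ u : ℕ → W, u 0 = a ∧ u (T.dist a b) = b ∧
      (∀ i < T.dist a b, T.Adj (u i) (u (i + 1))) ∧
      Set.InjOn u {i | i ≤ T.dist a b} := by
  obtain ⟨p, hp, hlen⟩ := hT.connected.exists_path_of_dist a b
  refine ⟨p.getVert, by simp, by rw [← hlen]; simp, ?_, ?_⟩
  · intro i hi; exact p.adj_getVert_succ (by omega)
  · rw [← hlen]; exact hp.getVert_injOn

namespace IsRooting

variable {r : W} {h : W → ℕ} {par : W → W}

theorem iterate_root (hr : T.IsRooting r h par) (j : ℕ) : par^[j] r = r :=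
  Function.iterate_fixed hr.par_root j

theorem height_iterate (hr : T.IsRooting r h par) {j : ℕ} {w : W} (hw : par^[j] w ≠ r) :
    h (par^[j] w) + j = h w := by
  induction j generalizing w with
  | zero => rfl
  | succ j ih =>
    rw [Function.iterate_succ_apply] at hw ⊢
    have := ih hw
    have hwr : w ≠ r := by
      rintro rfl
      exact hw (by rw [hr.par_root, hr.iterate_root])
    have := hr.height_par w hwr
    omega

theorem iterate_ne_root (hr : T.IsRooting r h par) (h0 : h r = 0) {j : ℕ} {w : W}
    (hj : j < h w) : par^[j] w ≠ r := by
  induction j generalizing w with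
  | zero => intro he; rw [Function.iterate_zero_apply] at he; rw [he] at hj; omega
  | succ j ih =>
    rw [Function.iterate_succ_apply]
    refine ih ?_
    have := hr.height_par w (by rintro rfl; omega)
    omega

theorem par_par_ne (hr : T.IsRooting r h par) {w : W} (hw : par w ≠ r) : par (par w) ≠ w := by
  intro he
  have h1 := hr.height_par (par w) hw
  have h2 := hr.height_par w (by rintro rfl; exact hw hr.par_root)
  rw [he] at h1
  omega

theorem nbWalk_iterate (hr : T.IsRooting r h par) {c : W} (hc : c ≠ r) {j : ℕ} {w : W}
    (hw : par^[j] w = c) : T.NBWalk (par c) c (par w) w (j + 1) := by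
  induction j generalizing w with
  | zero => subst hw; exact .single (hr.adj_par _ hc).symm
  | succ j ih =>
    rw [Function.iterate_succ_apply] at hw
    have h1 : par w ≠ r := by
      intro he; rw [he, hr.iterate_root] at hw; exact hc hw.symm
    have h2 : w ≠ r := by rintro rfl; exact h1 hr.par_root
    exact (ih hw).concat (hr.par_par_ne h1) (hr.adj_par _ h2).symm

theorem dist_iterate_le (hr : T.IsRooting r h par) (hT : T.IsTree) (w : W) (j : ℕ) :
    T.dist w (par^[j] w) ≤ j := by
  induction j generalizing w with
  | zero => simp
  | succ j ih =>
    rw [Function.iterate_succ_apply]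
    have h1 := hT.connected.dist_triangle (u := w) (v := par w) (w := par^[j] (par w))
    have h2 := ih (par w)
    have h3 : T.dist w (par w) ≤ 1 := by
      by_cases hw : w = r
      · rw [hw, hr.par_root]; simp
      · exact (dist_eq_one_iff_adj.2 (hr.adj_par w hw)).le
    omega

end IsRooting

/-- `f` is a locally injective homomorphism on `A` whose images have at least `δ` neighbours. -/
structure IsLocInj (T : SimpleGraph W) (B : SimpleGraph α) (δ : ℕ) (f : W → α) (A : Set W) :
    Prop where
  adj : ∀ a ∈ A, ∀ b ∈ A, T.Adj a b → B.Adj (f a) (f b)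
  inj : ∀ b ∈ A, ∀ a ∈ A, ∀ c ∈ A, T.Adj b a → T.Adj b c → f a = f c → a = c
  deg : ∀ a ∈ A, δ ≤ (B.neighborSet (f a)).ncard

namespace IsLocInj

variable {δ : ℕ} {f : W → α} {A : Set W}

theorem mono (hf : T.IsLocInj B δ f A) {A' : Set W} (h : A' ⊆ A) : T.IsLocInj B δ f A' :=
  ⟨fun a ha b hb => hf.adj a (h ha) b (h hb),
    fun b hb a ha c hc => hf.inj b (h hb) a (h ha) c (h hc), fun a ha => hf.deg a (h ha)⟩

theorem nbWalk (hf : T.IsLocInj B δ f Set.univ) {a b c d : W} {n : ℕ} (h : T.NBWalk a b c d n) :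
    B.NBWalk (f a) (f b) (f c) (f d) n :=
  h.map (fun x y hxy => hf.adj x trivial y trivial hxy)
    fun x y z hy hz he => hf.inj x trivial y trivial z trivial hy hz he

-- As `v` meets `A` only in `p`, local injectivity can fail only at `p`, and `hne` excludes that.
open Classical in
theorem update (hf : T.IsLocInj B δ f A)
    (hB : ∀ a b, B.Adj a b → δ ≤ (B.neighborSet b).ncard) {v p : W} (hv : v ∉ A) (hp : p ∈ A)
    (hpv : T.Adj p v) (huniq : ∀ a ∈ A, T.Adj v a → a = p) {y : α} (hy : B.Adj (f p) y)
    (hne : ∀ a ∈ A, T.Adj p a → f a ≠ y) :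
    T.IsLocInj B δ (Function.update f v y) (insert v A) := by
  have hu : ∀ a ∈ A, Function.update f v y a = f a := fun a ha =>
    Function.update_of_ne (by rintro rfl; exact hv ha) _ _
  have hvv : Function.update f v y v = y := Function.update_self ..
  refine ⟨?_, ?_, ?_⟩
  · rintro a (rfl | ha) b (rfl | hb) hab
    · exact (hab.ne rfl).elim
    · rw [hvv, hu b hb, huniq b hb hab]; exact hy.symm
    · rw [hvv, hu a ha, huniq a ha hab.symm]; exact hy
    · rw [hu a ha, hu b hb]; exact hf.adj a ha b hb hab
  · rintro b (rfl | hb) a ha c hc hba hbc he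
    · have ha' : a ∈ A := ha.resolve_left (by rintro rfl; exact hba.ne rfl)
      have hc' : c ∈ A := hc.resolve_left (by rintro rfl; exact hbc.ne rfl)
      rw [huniq a ha' hba, huniq c hc' hbc]
    · rcases ha with rfl | ha <;> rcases hc with rfl | hc
      · rfl
      · obtain rfl := huniq b hb hba.symm
        rw [hvv, hu c hc] at he
        exact (hne c hc hbc he.symm).elim
      · obtain rfl := huniq b hb hbc.symm
        rw [hvv, hu a ha] at he
        exact (hne a ha hba he).elim
      · rw [hu a ha, hu c hc] at he
        exact hf.inj b hb a ha c hc hba hbc he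
  · rintro a (rfl | ha)
    · rw [hvv]; exact hB _ _ hy
    · rw [hu a ha]; exact hf.deg a ha

/-- If `p ∈ A` has a neighbour outside `A`, then some neighbour of `f p` is not the image of a
neighbour of `p` in `A`. -/
theorem exists_free_neighbor [Finite W] (hf : T.IsLocInj B δ f A)
    (hT : ∀ w, (T.neighborSet w).ncard ≤ δ) {v p : W} (hv : v ∉ A) (hp : p ∈ A)
    (hpv : T.Adj p v) : ∃ y, B.Adj (f p) y ∧ ∀ a ∈ A, T.Adj p a → f a ≠ y := by
  have hlt : (f '' (T.neighborSet p ∩ A)).ncard < (B.neighborSet (f p)).ncard := by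
    refine (Set.ncard_image_le (Set.toFinite _)).trans_lt (lt_of_lt_of_le ?_ (hf.deg p hp))
    refine lt_of_lt_of_le (Set.ncard_lt_ncard ⟨Set.inter_subset_left, fun h => ?_⟩) (hT p)
    exact hv (h (show v ∈ T.neighborSet p from hpv)).2
  obtain ⟨y, hy, hy'⟩ := Set.exists_mem_notMem_of_ncard_lt_ncard hlt (Set.toFinite _)
  exact ⟨y, hy, fun a ha hpa he => hy' ⟨a, ⟨hpa, ha⟩, he⟩⟩

/-- Missing vertices are added by height: each then has its parent as only neighbour in the domain,
and the degree bound leaves a free image. -/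
theorem exists_extension [Finite W] {r : W} {h : W → ℕ} {par : W → W}
    (hr : T.IsRooting r h par) (hT : ∀ w, (T.neighborSet w).ncard ≤ δ)
    (hB : ∀ a b, B.Adj a b → δ ≤ (B.neighborSet b).ncard) (hA : r ∈ A)
    (hpar : ∀ a ∈ A, par a ∈ A) (hf : T.IsLocInj B δ f A) :
    ∃ f', T.IsLocInj B δ f' Set.univ ∧ ∀ a ∈ A, f' a = f a := by
  classical
  induction hn : (Aᶜ).ncard generalizing A f with
  | zero =>
    rw [Set.ncard_eq_zero, Set.compl_empty_iff] at hn
    subst hn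
    exact ⟨f, hf, fun _ _ => rfl⟩
  | succ n ih =>
    have hne : (Aᶜ).Nonempty := by
      rw [Set.nonempty_iff_ne_empty]; intro he; rw [he] at hn; simp at hn
    obtain ⟨v, hv, hmin⟩ := Set.exists_min_image _ h (Set.toFinite Aᶜ) hne
    have hvr : v ≠ r := by rintro rfl; exact hv hA
    have hpA : par v ∈ A := by
      by_contra hc
      have := hmin _ hc
      have := hr.height_par v hvr
      omega
    have hadj := (hr.adj_par v hvr).symm
    obtain ⟨y, hy, hyne⟩ := hf.exists_free_neighbor hT hv hpA hadj
    have huniq : ∀ a ∈ A, T.Adj v a → a = par v := by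
      intro a ha hva
      rcases hr.eq_par_or v a hva with ⟨-, h1⟩ | ⟨-, h1⟩
      · exact h1
      · exact (hv (h1 ▸ hpar a ha)).elim
    obtain ⟨f', hf', he⟩ := ih (A := insert v A) (Set.mem_insert_of_mem _ hA)
      (by rintro a (rfl | ha); exacts [Set.mem_insert_of_mem _ hpA,
            Set.mem_insert_of_mem _ (hpar a ha)])
      (hf.update hB hv hpA hadj huniq hy hyne) (by
        have : (insert v A)ᶜ = Aᶜ \ {v} := by ext; simp [not_or, and_comm]
        rw [this, Set.ncard_sdiff_singleton_of_mem hv, hn]; rfl)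
    refine ⟨f', hf', fun a ha => ?_⟩
    rw [he a (Set.mem_insert_of_mem _ ha), Function.update_of_ne]
    rintro rfl; exact hv ha

end IsLocInj

end SimpleGraph

/-! ### Relocation of subtrees and the counting argument -/

namespace SimpleGraph

variable {W α V : Type*} {T : SimpleGraph W} {B : SimpleGraph α}

open Classical in
/-- Let `f` be injective on `S` modulo `π`. If `f` cannot be modified so as to become injective on
`insert v S`, then the branches at the images of the ancestors of `v` are used by `S`: otherwise the
part of `T` below an ancestor could be moved to an unused branch. -/
theorem IsLocInj.exists_used_of_no_relocation [Finite W] {π : α → V} {δ ℓ : ℕ} {f : W → α}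
    {r : W} {par : W → W} (hT : T.IsTree) (hr : T.IsRooting r (T.dist r) par)
    (hdeg : ∀ w, (T.neighborSet w).ncard ≤ δ)
    (hB : ∀ a b, B.Adj a b → δ ≤ (B.neighborSet b).ncard)
    (hnb : ∀ a b c d n, B.NBWalk a b c d n → n ≤ 2 * ℓ → π a ≠ π d)
    {S : Set W} {v : W} (hvS : v ∉ S)
    (hS1 : ∀ w, T.dist r w < T.dist r v → w ∈ S) (hS2 : ∀ w ∈ S, T.dist r w ≤ T.dist r v)
    (hf : T.IsLocInj B δ f Set.univ) (hinj : Set.InjOn (π ∘ f) S)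
    (hno : ¬ ∃ f', T.IsLocInj B δ f' Set.univ ∧ f' r = f r ∧ Set.InjOn (π ∘ f') (insert v S))
    {i : ℕ} (hi1 : 1 ≤ i) (hiℓ : i ≤ ℓ) (hiv : i ≤ T.dist r v) {y : α}
    (hy : B.Adj (f (par^[i] v)) y) :
    ∃ w ∈ S, (∃ c d n, n ≤ i ∧ B.NBWalk (f (par^[i] v)) y c d n ∧ π d = π (f w)) ∧
      ((∃ a ∈ S, π (f a) = π y) → π (f w) = π y) := by
  -- If `π y` is already taken, its owner is the witness; below, `π y` is free and the subtree at
  -- `par^[i - 1] v` is moved to `y`.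
  by_cases hyS : ∃ a ∈ S, π (f a) = π y
  · obtain ⟨a, ha, hay⟩ := hyS
    exact ⟨a, ha, ⟨_, _, 1, hi1, .single hy, hay.symm⟩, fun _ => hay⟩
  by_contra hcon
  apply hno
  obtain ⟨j, rfl⟩ : ∃ j, i = j + 1 := ⟨i - 1, by omega⟩
  have h0 : T.dist r r = 0 := dist_self
  have hcr : par^[j] v ≠ r := hr.iterate_ne_root h0 (by omega)
  have hhc := hr.height_iterate hcr
  rw [Function.iterate_succ_apply'] at hy hcon
  set c := par^[j] v with hc
  set D : Set W := {w | ∃ k, par^[k] w = c} with hD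
  have hvD : v ∈ D := ⟨j, rfl⟩
  have hcD : c ∈ D := ⟨0, rfl⟩
  set A : Set W := S \ D with hA
  have hhp := hr.height_par c hcr
  have hpD : par c ∉ D := by
    rintro ⟨k, hk⟩
    have := hr.height_iterate (w := par c) (j := k) (by rw [hk]; exact hcr)
    rw [hk] at this
    omega
  have hpA : par c ∈ A := ⟨hS1 _ (by omega), hpD⟩
  have hcA : c ∉ A := fun hh => hh.2 hcD
  have hrA : r ∈ A := by
    refine ⟨hS1 _ (by omega), ?_⟩
    rintro ⟨k, hk⟩
    rw [hr.iterate_root] at hk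
    exact hcr hk.symm
  have hparA : ∀ a ∈ A, par a ∈ A := by
    rintro a ⟨haS, haD⟩
    refine ⟨?_, fun ⟨k, hk⟩ => haD ⟨k + 1, by rwa [Function.iterate_succ_apply]⟩⟩
    by_cases har : a = r
    · rw [har, hr.par_root]; exact hrA.1
    · have := hr.height_par a har
      have := hS2 a haS
      exact hS1 _ (by omega)
  have huniq : ∀ a ∈ A, T.Adj c a → a = par c := by
    intro a ha hca
    rcases hr.eq_par_or c a hca with ⟨-, h1⟩ | ⟨-, h1⟩
    · exact h1
    · exact (ha.2 ⟨1, h1.symm⟩).elim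
  have hloc := (hf.mono (Set.subset_univ A)).update hB hcA hpA (hr.adj_par c hcr).symm huniq hy
    (fun a ha _ he => hyS ⟨a, ha.1, by rw [he]⟩)
  obtain ⟨f', hf', he⟩ := hloc.exists_extension hr hdeg hB (Set.mem_insert_of_mem _ hrA) (by
    rintro a (rfl | ha)
    exacts [Set.mem_insert_of_mem _ hpA, Set.mem_insert_of_mem _ (hparA a ha)])
  have heA : ∀ a ∈ A, f' a = f a := by
    intro a ha
    rw [he a (Set.mem_insert_of_mem _ ha), Function.update_of_ne]
    rintro rfl; exact hcA ha
  have hec : f' c = y := by rw [he c (Set.mem_insert ..), Function.update_self]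
  have hheight : ∀ w ∈ insert v S, T.dist r w ≤ T.dist r v := by
    rintro w (rfl | hw); exacts [le_rfl, hS2 w hw]
  -- the vertices moved do not meet the vertices that stay
  have hmix : ∀ w ∈ insert v S, w ∈ D → ∀ a ∈ A, π (f' w) ≠ π (f' a) := by
    rintro w hw ⟨k, hk⟩ a ha heq
    have hwalk := hf'.nbWalk (hr.nbWalk_iterate hcr hk)
    rw [heA _ hpA, hec] at hwalk
    have h1 := hr.height_iterate (w := w) (j := k) (by rw [hk]; exact hcr)
    rw [hk] at h1
    have h2 := hheight w hw
    refine hcon ⟨a, ha.1, ⟨_, _, k + 1, by omega, hwalk, by rw [heq, heA a ha]⟩, fun h => ?_⟩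
    exact (hyS h).elim
  -- Moved vertices lie at most `j` below `c`, so two of them are at distance at most `2 * j < 2 *
  -- ℓ`, and their geodesic maps to a short walk.
  have hin : ∀ w ∈ insert v S, w ∈ D → ∀ w' ∈ insert v S, w' ∈ D → π (f' w) = π (f' w') →
      w = w' := by
    rintro w hw ⟨k, hk⟩ w' hw' ⟨k', hk'⟩ heq
    by_contra hne
    have h1 := hr.height_iterate (w := w) (j := k) (by rw [hk]; exact hcr)
    have h1' := hr.height_iterate (w := w') (j := k') (by rw [hk']; exact hcr)
    have h2 := hheight w hw
    have h2' := hheight w' hw'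
    have h3 := hr.dist_iterate_le hT w k
    have h3' := hr.dist_iterate_le hT w' k'
    rw [hk] at h1 h3
    rw [hk'] at h1' h3'
    have h4 := hT.connected.dist_triangle (u := w) (v := c) (w := w')
    rw [dist_comm (u := c)] at h4
    have hpos := hT.connected.pos_dist_of_ne hne
    obtain ⟨u, hu0, huL, huadj, huinj⟩ := hT.exists_geodesic w w'
    have hwalk : T.NBWalk (u 0) (u (0 + 1)) (u (0 + (T.dist w w' - 1)))
        (u (0 + (T.dist w w' - 1 + 1))) (T.dist w w' - 1 + 1) :=
      NBWalk.of_fun (n := T.dist w w') huadj (fun i hi heq => by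
        have := huinj (show i ≤ _ by omega) (show i + 2 ≤ _ by omega) heq
        omega) (by omega)
    have hwalk' := hf'.nbWalk hwalk
    refine hnb _ _ _ _ _ hwalk' (by omega) ?_
    rw [hu0, show 0 + (T.dist w w' - 1 + 1) = T.dist w w' by omega, huL, heq]
  refine ⟨f', hf', heA r hrA, ?_⟩
  intro w hw w' hw' heq
  have hmem : ∀ w ∈ insert v S, w ∉ D → w ∈ A := fun w hw hwD =>
    ⟨hw.resolve_left (by rintro rfl; exact hwD hvD), hwD⟩
  by_cases hwD : w ∈ D <;> by_cases hwD' : w' ∈ D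
  · exact hin w hw hwD w' hw' hwD' heq
  · exact (hmix w hw hwD w' (hmem w' hw' hwD') heq).elim
  · exact (hmix w' hw' hwD' w (hmem w hw hwD) heq.symm).elim
  · have h1 := hmem w hw hwD
    have h2 := hmem w' hw' hwD'
    refine hinj h1.1 h2.1 ?_
    simpa [heA w h1, heA w' h2] using heq

theorem NBWalk.eq_of_length_one {a b c d : α} {n : ℕ} (h : B.NBWalk a b c d n) (hn : n ≤ 1) :
    d = b := by
  cases h with
  | single => rfl
  | cons _ _ h' => have := h'.pos; omega

namespace IsRooting

variable {r : W} {h : W → ℕ} {par : W → W} {u : ℕ → W} {L : ℕ}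

/-- A path that goes away from the root at some step does so at every later step. -/
theorem descending (hr : T.IsRooting r h par) (hadj : ∀ i < L, T.Adj (u i) (u (i + 1)))
    (hinj : Set.InjOn u {i | i ≤ L}) {i : ℕ} (hi : u (i + 1) ≠ r ∧ u i = par (u (i + 1)))
    {m : ℕ} (hm : i + m ≤ L) : h (u (i + m)) = h (u i) + m := by
  have key : ∀ m, i + m < L → u (i + m + 1) ≠ r ∧ u (i + m) = par (u (i + m + 1)) := by
    intro m hm
    induction m with
    | zero => exact hi
    | succ m ih =>
      rcases hr.eq_par_or _ _ (hadj (i + (m + 1)) hm) with ⟨-, h1⟩ | h1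
      · have h2 := (ih (by omega)).2
        have := hinj (show i + (m + 1) + 1 ≤ L by omega) (show i + m ≤ L by omega)
          (h1.trans h2.symm)
        omega
      · exact h1
  induction m with
  | zero => rfl
  | succ m ih =>
    obtain ⟨h1, h2⟩ := key m (by omega)
    have := hr.height_par _ h1
    rw [← h2, ih (by omega)] at this
    rw [← add_assoc, ← this]
    omega

theorem ascending (hr : T.IsRooting r h par) {m : ℕ}
    (hup : ∀ i < m, u i ≠ r ∧ u (i + 1) = par (u i)) :
    u m = par^[m] (u 0) ∧ h (u m) + m = h (u 0) := by
  induction m with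
  | zero => exact ⟨rfl, rfl⟩
  | succ m ih =>
    obtain ⟨h1, h2⟩ := ih fun i hi => hup i (by omega)
    obtain ⟨h3, h4⟩ := hup m (by omega)
    have := hr.height_par _ h3
    rw [← h4] at this
    exact ⟨by rw [h4, h1, Function.iterate_succ_apply'], by omega⟩

end IsRooting

theorem IsLocInj.exists_injOn_insert [Finite W] [Finite α] {π : α → V} {δ ℓ : ℕ} {f : W → α}
    {r : W} {par : W → W} (hT : T.IsTree) (hr : T.IsRooting r (T.dist r) par)
    (hdeg : ∀ w, (T.neighborSet w).ncard ≤ δ)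
    (hB : ∀ a b, B.Adj a b → δ ≤ (B.neighborSet b).ncard) (hℓ : 1 ≤ ℓ)
    (hnb : ∀ a b c d n, B.NBWalk a b c d n → n ≤ 2 * ℓ → π a ≠ π d)
    {S : Set W} {v : W} (hvS : v ∉ S) (hrS : r ∈ S) (hcard : S.ncard ≤ ℓ * δ)
    (hS1 : ∀ w, T.dist r w < T.dist r v → w ∈ S) (hS2 : ∀ w ∈ S, T.dist r w ≤ T.dist r v)
    (hf : T.IsLocInj B δ f Set.univ) (hinj : Set.InjOn (π ∘ f) S) :
    ∃ f', T.IsLocInj B δ f' Set.univ ∧ f' r = f r ∧ Set.InjOn (π ∘ f') (insert v S) := by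
  classical
  by_contra hno
  have used := fun (i : ℕ) (h1 : 1 ≤ i) (h2 : i ≤ ℓ) (h3 : i ≤ T.dist r v) (y : α) =>
    hf.exists_used_of_no_relocation hT hr hdeg hB hnb hvS hS1 hS2 hinj hno h1 h2 h3 (y := y)
  have hvr : v ≠ r := by rintro rfl; exact hvS hrS
  have hhv := hr.height_par v hvr
  have hpS : par v ∈ S := hS1 _ (by omega)
  have hpv : T.Adj (par v) v := (hr.adj_par v hvr).symm
  have hδ : 1 ≤ δ := by
    refine le_trans ?_ (hdeg (par v))
    exact (Set.ncard_pos (Set.toFinite _)).2 ⟨v, hpv⟩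
  obtain ⟨y₀, hy₀, hy₀ne⟩ :=
    (hf.mono (Set.subset_univ S)).exists_free_neighbor hdeg hvS hpS hpv
  -- For the parent of `v` the walk has length one, so `b` occupies `π y₀` itself.
  obtain ⟨b, hbS, ⟨c, d, n, hn, hwalk, hd⟩, -⟩ := used 1 le_rfl hℓ (by omega) y₀ hy₀
  rw [hwalk.eq_of_length_one hn] at hd
  have hbp : par v ≠ b := by
    rintro rfl
    exact hnb _ _ _ _ _ (NBWalk.single hy₀) (by omega) hd.symm
  obtain ⟨u, hu0, huL, huadj, huinj⟩ := hT.exists_geodesic (par v) b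
  have hLpos := hT.connected.pos_dist_of_ne hbp
  set L := T.dist (par v) b with hL
  have hdesc : ∀ i < L, (u (i + 1) ≠ r ∧ u i = par (u (i + 1))) →
      T.dist r b = T.dist r (u i) + (L - i) := by
    intro i hi h1
    have := hr.descending huadj huinj h1 (m := L - i) (by omega)
    rwa [show i + (L - i) = L by omega, huL] at this
  have hbv := hS2 b hbS
  have huS : ∀ i ≤ L, u i ∈ S := by
    intro i hi
    by_cases hex : ∃ i' < i, u (i' + 1) ≠ r ∧ u i' = par (u (i' + 1))
    · obtain ⟨i', hi', h1⟩ := hex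
      have h2 := hdesc i' (by omega) h1
      have h3 := hr.descending huadj huinj h1 (m := i - i') (by omega)
      rw [show i' + (i - i') = i by omega] at h3
      rcases hi.lt_or_eq with hlt | rfl
      · exact hS1 _ (by omega)
      · rwa [huL]
    · push Not at hex
      have h1 : ∀ i' < i, u i' ≠ r ∧ u (i' + 1) = par (u i') := fun i' hi' =>
        (hr.eq_par_or _ _ (huadj i' (by omega))).resolve_right fun hh => hex i' hi' hh.1 hh.2
      have h2 := (hr.ascending h1).2
      rw [hu0] at h2
      exact hS1 _ (by omega)
  set X : ℕ → α := fun i => f (u i) with hX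
  have hne2 : ∀ i, i + 2 ≤ L → u i ≠ u (i + 2) := fun i hi he => by
    have := huinj (show i ≤ L by omega) (show i + 2 ≤ L from hi) he
    omega
  have hXwalk : ∀ i m, i < m → m ≤ L → B.NBWalk (X i) (X (i + 1)) (X (m - 1)) (X m) (m - i) := by
    intro i m him hmL
    have := hf.nbWalk (NBWalk.of_fun huadj hne2 (i := i) (k := m - i - 1) (by omega))
    rwa [show i + (m - i - 1) = m - 1 by omega, show i + (m - i - 1 + 1) = m by omega,
      show m - i - 1 + 1 = m - i by omega] at this
  -- The edge from `y₀` followed by the image of the path to `b` is closed modulo `π` and has length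
  -- `L + 1`.
  have hL2 : 2 * ℓ ≤ L := by
    by_contra hlt
    have h1 := hXwalk 0 L (by omega) le_rfl
    have h2 : y₀ ≠ X 1 := by
      have := hy₀ne (u 1) (huS 1 hLpos) (hu0 ▸ huadj 0 hLpos)
      exact this.symm
    have h3 : B.Adj y₀ (X 0) := by simpa [hX, hu0] using hy₀.symm
    refine hnb _ _ _ _ _ (NBWalk.cons h3 h2 h1) (by omega) ?_
    rw [hd]; simp [hX, huL]
  -- Turning downwards before step `ℓ` would put `b` higher than `v` in height, as `L ≥ 2 * ℓ`.
  have hup : ∀ i < ℓ, u i ≠ r ∧ u (i + 1) = par (u i) := by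
    intro i
    induction i using Nat.strong_induction_on with
    | _ i ih =>
      intro hi
      have h1 := (hr.ascending fun i' hi' => ih i' hi' (by omega)).2
      refine (hr.eq_par_or _ _ (huadj i (by omega))).resolve_right fun hh => ?_
      have h2 := hdesc i (by omega) hh
      rw [hu0] at h1
      omega
  have hanc : ∀ j ≤ ℓ, u j = par^[j + 1] v := by
    intro j hj
    rw [(hr.ascending fun i hi => hup i (by omega)).1, hu0, Function.iterate_succ_apply]
  have hvℓ : ℓ + 1 ≤ T.dist r v := by
    have := (hr.ascending hup).2
    rw [hu0] at this
    omega
  have hex : ∀ j y, ∃ w, j < ℓ → B.Adj (X j) y →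
      w ∈ S ∧ (∃ c d n, n ≤ j + 1 ∧ B.NBWalk (X j) y c d n ∧ π d = π (f w)) ∧
      ((∃ a ∈ S, π (f a) = π y) → π (f w) = π y) := by
    intro j y
    by_cases hc : j < ℓ ∧ B.Adj (X j) y
    · have h1 : X j = f (par^[j + 1] v) := by rw [← hanc j hc.1.le]
      obtain ⟨w, hw, hw'⟩ := used (j + 1) (by omega) (by omega) (by omega) y (h1 ▸ hc.2)
      exact ⟨w, fun _ _ => ⟨hw, h1 ▸ hw'⟩⟩
    · exact ⟨r, fun h1 h2 => (hc ⟨h1, h2⟩).elim⟩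
  choose Φ hΦ using hex
  -- Going back from `X m` to `X j` and on into the branch `y` takes at most `(m - j) + (j + 1) ≤ 2
  -- * ℓ` steps.
  have hpath : ∀ j < ℓ, ∀ y, B.Adj (X j) y → y ≠ X (j + 1) → ∀ m, j ≤ m → m < 2 * ℓ →
      π (f (Φ j y)) ≠ π (X m) := by
    intro j hj y hy hyne m hjm hm he
    obtain ⟨-, ⟨c, d, n, hn, hw, hd⟩, -⟩ := hΦ j y hj hy
    rcases hjm.eq_or_lt with rfl | hlt
    · exact hnb _ _ _ _ _ hw (by omega) (by rw [hd, he])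
    · exact hnb _ _ _ _ _ ((hXwalk j m hlt (by omega)).reverse.append hyne.symm hw) (by omega)
        (by rw [hd, he])
  have hlt : ∀ j' j, j' < j → j < ℓ → ∀ y y', B.Adj (X j) y → B.Adj (X j') y' →
      y' ≠ X (j' + 1) → Φ j y ≠ Φ j' y' := by
    intro j' j hjj hj y y' hy hy' hyne' he
    obtain ⟨-, ⟨c, d, n, hn, hw, hd⟩, huse⟩ := hΦ j y hj hy
    obtain ⟨-, ⟨c', d', n', hn', hw', hd'⟩, -⟩ := hΦ j' y' (by omega) hy'
    -- Here the joined walk would backtrack; but then the occupant has the same projection as `X (j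
    -- - 1)`, and `hpath` applies.
    by_cases hyX : y = X (j - 1)
    · have h1 := huse ⟨u (j - 1), huS _ (by omega), by rw [hyX]⟩
      refine hpath j' (by omega) y' hy' hyne' (j - 1) (by omega) (by omega) ?_
      rw [← he, h1, hyX]
    · refine hnb _ _ _ _ _ ((hw.reverse.append hyX
        (hXwalk j' j hjj (by omega)).reverse).append hyne'.symm hw') (by omega) ?_
      rw [hd, hd', he]
  have hsame : ∀ j < ℓ, ∀ y y', B.Adj (X j) y → B.Adj (X j) y' → Φ j y = Φ j y' → y = y' := by
    intro j hj y y' hy hy' he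
    by_contra hne
    obtain ⟨-, ⟨c, d, n, hn, hw, hd⟩, -⟩ := hΦ j y hj hy
    obtain ⟨-, ⟨c', d', n', hn', hw', hd'⟩, -⟩ := hΦ j y' hj hy'
    refine hnb _ _ _ _ _ (hw.reverse.append hne hw') (by omega) ?_
    rw [hd, hd', he]
  have := Fintype.ofFinite α
  have := Fintype.ofFinite W
  -- The branch towards `X (j + 1)` is dropped, leaving at least `δ - 1` branches.
  let N : ℕ → Finset α := fun j => (B.neighborSet (X j) \ {X (j + 1)}).toFinset
  have hN : ∀ j y, y ∈ N j ↔ B.Adj (X j) y ∧ y ≠ X (j + 1) := by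
    intro j y; simp [N]
  have hNcard : ∀ j, δ - 1 ≤ (N j).card := by
    intro j
    rw [← Set.ncard_eq_toFinset_card']
    have h1 := Set.ncard_le_ncard_sdiff_add_ncard (B.neighborSet (X j)) {X (j + 1)}
      (Set.toFinite _)
    have h2 : δ ≤ (B.neighborSet (X j)).ncard := hf.deg (u j) trivial
    simp only [Set.ncard_singleton] at h1
    omega
  let I : Finset (Σ _ : ℕ, α) := (Finset.range ℓ).sigma N
  have hI : ℓ * (δ - 1) ≤ I.card := by
    rw [Finset.card_sigma]
    calc ℓ * (δ - 1) = ∑ _j ∈ Finset.range ℓ, (δ - 1) := by simp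
      _ ≤ _ := Finset.sum_le_sum fun j _ => hNcard j
  have hIinj : Set.InjOn (fun p : Σ _ : ℕ, α => Φ p.1 p.2) (I : Set (Σ _ : ℕ, α)) := by
    rintro ⟨j, y⟩ h1 ⟨j', y'⟩ h2 he
    simp only [I, Finset.coe_sigma, Set.mem_sigma_iff, Finset.mem_coe, Finset.mem_range, hN]
      at h1 h2
    rcases lt_trichotomy j j' with hjj | rfl | hjj
    · exact (hlt j j' hjj h2.1 y' y h2.2.1 h1.2.1 h1.2.2 he.symm).elim
    · rw [hsame j h1.1 y y' h1.2.1 h2.2.1 he]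
    · exact (hlt j' j hjj h1.1 y y' h1.2.1 h2.2.1 h2.2.2 he).elim
  -- From `ℓ - 1` on, every index is at least each `j < ℓ`, so `hpath` separates these `ℓ + 1`
  -- vertices from all occupants.
  let P : Finset W := (Finset.Icc (ℓ - 1) (2 * ℓ - 1)).image u
  have hP : P.card = ℓ + 1 := by
    rw [Finset.card_image_of_injOn, Nat.card_Icc]
    · omega
    · refine huinj.mono fun i hi => ?_
      have := (Finset.mem_Icc.1 hi).2
      show i ≤ L
      omega
  have hdisj : Disjoint (I.image fun p => Φ p.1 p.2) P := by
    rw [Finset.disjoint_left]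
    intro w h1 h2
    obtain ⟨⟨j, y⟩, hp, rfl⟩ := Finset.mem_image.1 h1
    obtain ⟨m, hm, he⟩ := Finset.mem_image.1 h2
    simp only [I, Finset.mem_sigma, Finset.mem_range, hN] at hp
    rw [Finset.mem_Icc] at hm
    exact hpath j hp.1 y hp.2.1 hp.2.2 m (by omega) (by omega) (by rw [← he])
  have hsub : (I.image fun p => Φ p.1 p.2) ∪ P ⊆ S.toFinset := by
    intro w hw
    rw [Set.mem_toFinset]
    rcases Finset.mem_union.1 hw with h1 | h1
    · obtain ⟨⟨j, y⟩, hp, rfl⟩ := Finset.mem_image.1 h1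
      simp only [I, Finset.mem_sigma, Finset.mem_range, hN] at hp
      exact (hΦ j y hp.1 hp.2.1).1
    · obtain ⟨m, hm, rfl⟩ := Finset.mem_image.1 h1
      rw [Finset.mem_Icc] at hm
      exact huS m (by omega)
  have hle := Finset.card_le_card hsub
  rw [Finset.card_union_of_disjoint hdisj, Finset.card_image_of_injOn hIinj, hP,
    ← Set.ncard_eq_toFinset_card'] at hle
  have hmul : ℓ * δ = ℓ * (δ - 1) + ℓ := by
    obtain ⟨e, rfl⟩ : ∃ e, δ = e + 1 := ⟨δ - 1, by omega⟩
    simp [mul_add]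
  omega

/-- A tree with at most `ℓ * δ` edges and maximum degree at most `δ` maps homomorphically to `B`,
injectively modulo `π`, if all degrees of non-isolated vertices of `B` are at least `δ` and no
non-backtracking walk of length at most `2 * ℓ` is closed modulo `π`. -/
theorem IsTree.exists_hom_injective [Finite W] [Finite α] {π : α → V} {δ ℓ : ℕ}
    (hT : T.IsTree) (hdeg : ∀ w, (T.neighborSet w).ncard ≤ δ)
    (hB : ∀ a b, B.Adj a b → δ ≤ (B.neighborSet b).ncard) (hℓ : 1 ≤ ℓ)
    (hnb : ∀ a b c d n, B.NBWalk a b c d n → n ≤ 2 * ℓ → π a ≠ π d)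
    (hcard : Nat.card W ≤ ℓ * δ + 1) (r : W) (a₀ : α) (ha₀ : δ ≤ (B.neighborSet a₀).ncard) :
    ∃ f : W → α, f r = a₀ ∧ (∀ w w', T.Adj w w' → B.Adj (f w) (f w')) ∧
      Function.Injective (π ∘ f) := by
  classical
  obtain ⟨par, hr⟩ := hT.exists_isRooting r
  have base : T.IsLocInj B δ (fun _ => a₀) {r} :=
    ⟨by rintro a rfl b rfl hab; exact (hab.ne rfl).elim,
      by rintro b rfl a rfl c rfl _ _ _; rfl, fun _ _ => ha₀⟩
  obtain ⟨f₀, hf₀, he₀⟩ := base.exists_extension hr hdeg hB (Set.mem_singleton r)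
    (fun a ha => by rw [Set.mem_singleton_iff] at *; rw [ha, hr.par_root])
  have main : ∀ n (S : Set W), r ∈ S → (∀ w ∈ S, ∀ w' ∉ S, T.dist r w ≤ T.dist r w') →
      (∃ f, T.IsLocInj B δ f Set.univ ∧ f r = a₀ ∧ Set.InjOn (π ∘ f) S) → (Sᶜ).ncard = n →
      ∃ f, T.IsLocInj B δ f Set.univ ∧ f r = a₀ ∧ Set.InjOn (π ∘ f) Set.univ := by
    intro n
    induction n with
    | zero =>
      intro S _ _ hf hn
      rw [Set.ncard_eq_zero, Set.compl_empty_iff] at hn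
      rwa [hn] at hf
    | succ n ih =>
      rintro S hrS hmono ⟨f, hf, hfr, hinj⟩ hn
      have hne : (Sᶜ).Nonempty := by
        rw [Set.nonempty_iff_ne_empty]; intro he; rw [he] at hn; simp at hn
      obtain ⟨v, hv, hmin⟩ := Set.exists_min_image _ (T.dist r) (Set.toFinite Sᶜ) hne
      have hScard : S.ncard ≤ ℓ * δ := by
        have := Set.ncard_add_ncard_compl S
        omega
      obtain ⟨f', hf', hfr', hinj'⟩ := hf.exists_injOn_insert hT hr hdeg hB hℓ hnb hv hrS hScard
        (fun w hw => by by_contra hc; exact absurd (hmin w hc) (by omega))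
        (fun w hw => hmono w hw v hv) hinj
      refine ih (insert v S) (Set.mem_insert_of_mem _ hrS) ?_ ⟨f', hf', hfr'.trans hfr, hinj'⟩ ?_
      · rintro w (rfl | hw) w' hw'
        · exact hmin w' fun h => hw' (Set.mem_insert_of_mem _ h)
        · exact hmono w hw w' fun h => hw' (Set.mem_insert_of_mem _ h)
      · have : (insert v S)ᶜ = Sᶜ \ {v} := by ext; simp [not_or, and_comm]
        rw [this, Set.ncard_sdiff_singleton_of_mem hv, hn]; rfl
  obtain ⟨f, hf, hfr, hinj⟩ := main _ {r} rfl (by rintro w rfl w' _; simp)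
    ⟨f₀, hf₀, he₀ r rfl, Set.injOn_singleton _ _⟩ rfl
  exact ⟨f, hfr, fun w w' h => hf.adj w trivial w' trivial h, Set.injOn_univ.1 hinj⟩

end SimpleGraph

/-! ### Girth and closed non-backtracking walks -/

namespace SimpleGraph

/-- In a graph of girth greater than `m`, non-backtracking walks of length at most `m` are not
closed. -/
theorem NBWalk.ne_of_lt_egirth {α : Type*} {G : SimpleGraph α} {m n : ℕ}
    (hG : (m : ℕ∞) + 1 ≤ G.egirth) {a b c d : α} (h : G.NBWalk a b c d n) (hn : n ≤ m) :
    a ≠ d := by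
  rintro rfl
  obtain ⟨p, hp0, -, hpn, hadj, hne⟩ := h.exists_fun
  obtain ⟨i, k, hk, hik, heq, hinj⟩ := exists_minimal_closed_segment p h.pos (hp0.trans hpn.symm)
  have hk3 : 3 ≤ k := by
    by_contra hlt
    obtain rfl | rfl : k = 1 ∨ k = 2 := by omega
    · exact (hadj i (by omega)).ne heq
    · exact hne i (by omega) heq
  have hclose : ∀ s < k, G.Adj (p (i + s)) (p (i + (s + 1) % k)) := by
    intro s hs
    rcases (show s + 1 ≤ k from hs).lt_or_eq with hlt | he
    · rw [Nat.mod_eq_of_lt hlt]; exact hadj (i + s) (by omega)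
    · rw [he, Nat.mod_self, add_zero, heq]
      have := hadj (i + s) (by omega)
      rwa [show i + s + 1 = i + k by omega] at this
  have hval : ∀ x y : Fin k, (x - y).val = 1 → x.val = (y.val + 1) % k := by
    intro x y hxy
    have hx := x.isLt
    have hy := y.isLt
    rw [Fin.sub_def] at hxy
    simp only at hxy
    rcases le_or_gt y.val x.val with hle | hlt
    · rw [show k - y.val + x.val = (x.val - y.val) + k by omega, Nat.add_mod_right,
        Nat.mod_eq_of_lt (by omega)] at hxy
      rw [Nat.mod_eq_of_lt (by omega)]; omega
    · rw [Nat.mod_eq_of_lt (by omega)] at hxy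
      rw [show y.val + 1 = k by omega, Nat.mod_self]; omega
  have hcont : cycleGraph k ⊑ G := by
    refine ⟨⟨⟨fun x => p (i + x.val), ?_⟩, ?_⟩⟩
    · intro x y hxy
      rcases cycleGraph_adj'.1 hxy with h1 | h1
      · show G.Adj _ _
        rw [hval x y h1]; exact (hclose y y.isLt).symm
      · show G.Adj _ _
        rw [hval y x h1]; exact hclose x x.isLt
    · intro x y hxy
      exact Fin.ext (hinj x x.isLt y y.isLt hxy)
  obtain ⟨v, w, hw, hwk⟩ := (cycleGraph_isContained_iff (by omega)).1 hcont
  have h1 := hG.trans (egirth_le_length hw)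
  rw [hwk] at h1
  have h2 : m + 1 ≤ k := by exact_mod_cast h1
  omega

end SimpleGraph

/-! ### The split graph of a digraph -/

namespace Digraph

/-- The bipartite graph whose two classes are copies of `V`, where the arc `vw` of `D` becomes an
edge from the first copy of `v` to the second copy of `w`. -/
def splitGraph {V : Type*} (D : Digraph V) : SimpleGraph (V × Bool) where
  Adj x y := (x.2 = true ∧ y.2 = false ∧ D.Adj x.1 y.1) ∨
    (x.2 = false ∧ y.2 = true ∧ D.Adj y.1 x.1)
  symm := ⟨by
    rintro x y (⟨h1, h2, h3⟩ | ⟨h1, h2, h3⟩)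
    · exact Or.inr ⟨h2, h1, h3⟩
    · exact Or.inl ⟨h2, h1, h3⟩⟩
  loopless := ⟨by rintro x (⟨h1, h2, -⟩ | ⟨h1, h2, -⟩) <;> simp [h1] at h2⟩

variable {V W : Type*} {D : Digraph V}

theorem splitGraph_adj_snd {x y : V × Bool} (h : D.splitGraph.Adj x y) : y.2 = !x.2 := by
  rcases h with ⟨h1, h2, -⟩ | ⟨h1, h2, -⟩ <;> simp [h1, h2]

theorem ncard_neighborSet_splitGraph_true (v : V) :
    (D.splitGraph.neighborSet (v, true)).ncard = D.outDeg v := by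
  have : D.splitGraph.neighborSet (v, true) = (fun w => (w, false)) '' {w | D.Adj v w} := by
    ext ⟨w, b⟩
    cases b <;> simp [splitGraph]
  rw [this, Set.ncard_image_of_injective _ (fun a b h => (Prod.mk.inj h).1), outDeg]

theorem ncard_neighborSet_splitGraph_false (v : V) :
    (D.splitGraph.neighborSet (v, false)).ncard = D.inDeg v := by
  have : D.splitGraph.neighborSet (v, false) = (fun w => (w, true)) '' {w | D.Adj w v} := by
    ext ⟨w, b⟩
    cases b <;> simp [splitGraph]
  rw [this, Set.ncard_image_of_injective _ (fun a b h => (Prod.mk.inj h).1), inDeg]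

theorem minPseudoSemidegree_le [Finite V] {x y : V × Bool} (h : D.splitGraph.Adj x y) :
    D.minPseudoSemidegree ≤ (D.splitGraph.neighborSet y).ncard := by
  have hpos : 0 < (D.splitGraph.neighborSet y).ncard :=
    (Set.ncard_pos (Set.toFinite _)).2 ⟨x, h.symm⟩
  have hex : ∃ v w, D.Adj v w := by
    rcases h with ⟨-, -, h⟩ | ⟨-, -, h⟩ <;> exact ⟨_, _, h⟩
  rw [minPseudoSemidegree, if_pos hex]
  obtain ⟨v, _ | _⟩ := y
  · rw [ncard_neighborSet_splitGraph_false] at hpos ⊢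
    exact (min_le_right _ _).trans (Nat.sInf_le ⟨hpos, v, rfl⟩)
  · rw [ncard_neighborSet_splitGraph_true] at hpos ⊢
    exact (min_le_left _ _).trans (Nat.sInf_le ⟨hpos, v, rfl⟩)

/-- A minimal segment closed in the first coordinate is an oriented cycle of `D`. The sides
alternate along it, so its first two arcs point in opposite senses. The two ends may be different
copies of one vertex, which covers odd cycles. -/
theorem NonDirectedCycleFree.fst_ne_of_nbWalk {m : ℕ} (hD : D.NonDirectedCycleFree m)
    (hloop : D.IsLoopless) {a b c d : V × Bool} {n : ℕ} (h : D.splitGraph.NBWalk a b c d n)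
    (hn : n ≤ m) : a.1 ≠ d.1 := by
  intro had
  obtain ⟨p, hp0, -, hpn, hadj, hne⟩ := h.exists_fun
  obtain ⟨i, k, hk, hik, heq, hinj⟩ :=
    SimpleGraph.exists_minimal_closed_segment (fun t => (p t).1) h.pos
      (show (p 0).1 = (p n).1 by rw [hp0, hpn, had])
  have hk3 : 3 ≤ k := by
    by_contra hlt
    obtain rfl | rfl : k = 1 ∨ k = 2 := by omega
    · rcases hadj i (by omega) with ⟨-, -, h1⟩ | ⟨-, -, h1⟩ <;>
        exact hloop _ (by simpa [heq] using h1)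
    -- After two steps the side is the same again, so equal projections mean backtracking; a pair of
    -- opposite arcs gives no closed walk.
    · refine hne i (by omega) (Prod.ext heq ?_)
      have h1 := splitGraph_adj_snd (hadj i (by omega))
      have h2 := splitGraph_adj_snd (hadj (i + 1) (by omega))
      rw [h1, Bool.not_not] at h2
      exact h2.symm
  have : NeZero k := ⟨by omega⟩
  have : Fact (1 < k) := ⟨by omega⟩
  have hnext : ∀ s : ZMod k, (p (i + (s + 1).val)).1 = (p (i + s.val + 1)).1 := by
    intro s
    have hs := s.val_lt
    rw [ZMod.val_add, ZMod.val_one]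
    rcases (show s.val + 1 ≤ k from hs).lt_or_eq with hlt | he
    · rw [Nat.mod_eq_of_lt hlt]; rfl
    · rw [he, Nat.mod_self, add_zero, heq, add_assoc, he]
  refine hD k (fun s => (p (i + s.val)).2) hk3 (by omega) ?_
    ⟨fun s => (p (i + s.val)).1, ?_, ?_⟩
  · intro hall
    have h1 := hall 0 1
    have h2 := splitGraph_adj_snd (hadj i (by omega))
    simp only [ZMod.val_zero, ZMod.val_one, add_zero] at h1
    rw [← h1] at h2
    simp at h2
  · intro s t hst
    exact ZMod.val_injective _ (hinj _ s.val_lt _ t.val_lt hst)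
  · rintro s t (⟨rfl, hs⟩ | ⟨rfl, ht⟩)
    · have hs' := s.val_lt
      simp only [hnext]
      rcases hadj (i + s.val) (by omega) with ⟨-, -, h1⟩ | ⟨h1, -, -⟩
      · exact h1
      · simp [h1] at hs
    · have ht' := t.val_lt
      simp only [hnext]
      rcases hadj (i + t.val) (by omega) with ⟨h1, -, -⟩ | ⟨-, -, h1⟩
      · simp [h1] at ht
      · exact h1

theorem IsAntidirectedTree.not_adj_of_adj {T : Digraph W} (hT : T.IsAntidirectedTree) {a b c : W}
    (hab : T.Adj a b) : ¬ T.Adj b c := by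
  intro hbc
  obtain ⟨⟨⟨hloop, hor⟩, -⟩, hno⟩ := hT
  refine hno ⟨a, b, c, ?_, ?_, ?_, hab, hbc⟩
  · rintro rfl; exact hloop _ hab
  · rintro rfl; exact hloop _ hbc
  · rintro rfl; exact hor _ _ hab hbc

theorem toSimpleGraphInclusive_adj_of_adj {T : Digraph W} (hT : T.IsLoopless) {a b : W}
    (hab : T.Adj a b) : T.toSimpleGraphInclusive.Adj a b :=
  (SimpleGraph.fromRel_adj ..).2 ⟨by rintro rfl; exact hT _ hab, Or.inl hab⟩

theorem card_le_numArcs_add_one [Finite W] {T : Digraph W}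
    (hT : T.toSimpleGraphInclusive.IsTree) : Nat.card W ≤ T.numArcs + 1 := by
  refine hT.connected.card_vert_le_card_edgeSet_add_one.trans (Nat.add_le_add_right ?_ 1)
  rw [Nat.card_coe_set_eq]
  refine (Set.ncard_le_ncard (t := (fun e : W × W => s(e.1, e.2)) '' {e | T.Adj e.1 e.2}) ?_
    (Set.toFinite _)).trans (Set.ncard_image_le (Set.toFinite _))
  intro e
  induction e with
  | _ a b =>
    intro h
    rcases ((SimpleGraph.fromRel_adj ..).1 h).2 with h1 | h1
    · exact ⟨(a, b), h1, rfl⟩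
    · exact ⟨(b, a), h1, Sym2.eq_swap⟩

theorem contains_of_minPseudoSemidegree [Finite V] [Nonempty V] [Fintype W] {T : Digraph W}
    {ℓ : ℕ} (hℓ : 1 ≤ ℓ) (hloop : D.IsLoopless) (hT : T.IsAntidirectedTree)
    (hcard : T.numArcs ≤ ℓ * D.minPseudoSemidegree) (hdeg : T.maxDeg ≤ D.minPseudoSemidegree)
    (hD : D.NonDirectedCycleFree (2 * ℓ)) : D.Contains T := by
  classical
  obtain ⟨r⟩ := hT.1.2.connected.nonempty
  set s : W → Bool := fun w => decide (∃ x, T.Adj w x) with hs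
  have hs_true : ∀ a b, T.Adj a b → s a = true := fun a b hab => decide_eq_true ⟨b, hab⟩
  have hs_false : ∀ a b, T.Adj a b → s b = false := fun a b hab =>
    decide_eq_false fun ⟨c, hc⟩ => hT.not_adj_of_adj hab hc
  have hdegT : ∀ w, (T.toSimpleGraphInclusive.neighborSet w).ncard ≤ D.minPseudoSemidegree := by
    intro w
    refine le_trans ?_ hdeg
    rw [Set.ncard_eq_toFinset_card', maxDeg]
    exact SimpleGraph.degree_le_maxDegree _ w
  obtain ⟨a₀, ha₀, hdeg₀⟩ : ∃ a₀ : V × Bool, a₀.2 = s r ∧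
      D.minPseudoSemidegree ≤ (D.splitGraph.neighborSet a₀).ncard := by
    by_cases hex : ∃ v w, D.Adj v w
    · obtain ⟨v, w, hvw⟩ := hex
      have hadj : D.splitGraph.Adj (v, true) (w, false) := Or.inl ⟨rfl, rfl, hvw⟩
      cases hsr : s r
      · exact ⟨(w, false), rfl, minPseudoSemidegree_le hadj⟩
      · exact ⟨(v, true), rfl, minPseudoSemidegree_le hadj.symm⟩
    -- Without arcs the pseudo-semidegree is `0`, and any vertex will do.
    · exact ⟨(Classical.arbitrary V, s r), rfl, by simp [minPseudoSemidegree, hex]⟩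
  obtain ⟨f, hfr, hf, hinj⟩ := hT.1.2.exists_hom_injective hdegT
    (fun x y h => minPseudoSemidegree_le h) hℓ
    (fun a b c d n h hn => hD.fst_ne_of_nbWalk hloop h hn)
    ((card_le_numArcs_add_one hT.1.2).trans (Nat.add_le_add_right hcard 1)) r a₀ hdeg₀
  have hstep : ∀ a b, T.toSimpleGraphInclusive.Adj a b → s b = !s a := by
    intro a b hab
    rcases ((SimpleGraph.fromRel_adj ..).1 hab).2 with h | h
    · rw [hs_true _ _ h, hs_false _ _ h]; rfl
    · rw [hs_true _ _ h, hs_false _ _ h]; rfl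
  -- Both sides flip along every edge and agree at `r`.
  have hsign : ∀ w, (f w).2 = s w := by
    intro w
    obtain ⟨p⟩ := hT.1.2.connected r w
    have key : ∀ a b (q : T.toSimpleGraphInclusive.Walk a b), (f a).2 = s a → (f b).2 = s b := by
      intro a b q
      induction q with
      | nil => exact id
      | cons hab _ ih =>
        intro ha
        exact ih (by rw [splitGraph_adj_snd (hf _ _ hab), ha, hstep _ _ hab])
    exact key r w p (by rw [hfr, ha₀])
  refine ⟨fun w => (f w).1, hinj, fun a b hab => ?_⟩
  rcases hf a b (toSimpleGraphInclusive_adj_of_adj hT.1.1.1 hab) with ⟨-, -, h⟩ | ⟨h, -, -⟩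
  · exact h
  · rw [hsign, hs_true _ _ hab] at h
    exact absurd h (by simp)

end Digraph

/-! ### Jiang's theorem and the conclusion -/

theorem SimpleGraph.IsTree.isContained_of_lt_egirth {V W : Type*} [Fintype V] [Nonempty V]
    [Fintype W] {G : SimpleGraph V} {T : SimpleGraph W} [DecidableRel G.Adj] [DecidableRel T.Adj]
    {ℓ : ℕ} (hℓ : 1 ≤ ℓ) (hT : T.IsTree) (hcard : T.edgeSet.ncard ≤ ℓ * G.minDegree)
    (hdeg : T.maxDegree ≤ G.minDegree) (hG : 2 * (ℓ : ℕ∞) + 1 ≤ G.egirth) : T.IsContained G := by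
  classical
  obtain ⟨r⟩ := hT.connected.nonempty
  have hB : ∀ v, G.minDegree ≤ (G.neighborSet v).ncard := by
    intro v
    rw [Set.ncard_eq_toFinset_card']
    exact G.minDegree_le_degree v
  obtain ⟨f, -, hf, hinj⟩ := hT.exists_hom_injective (π := id) (B := G) (δ := G.minDegree)
    (fun w => by
      rw [Set.ncard_eq_toFinset_card']
      exact (T.degree_le_maxDegree w).trans hdeg)
    (fun _ y _ => hB y) hℓ
    (fun a b c d n h hn => h.ne_of_lt_egirth (m := 2 * ℓ) (by exact_mod_cast hG) hn)
    (hT.connected.card_vert_le_card_edgeSet_add_one.trans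
      (Nat.add_le_add_right (by rwa [Nat.card_coe_set_eq]) 1)) r (Classical.arbitrary V) (hB _)
  exact ⟨⟨⟨f, fun {a b} h => hf a b h⟩, hinj⟩⟩

theorem Nat.le_mul_of_div_le_cast {k ℓ d : ℕ} (hℓ : 1 ≤ ℓ) (h : (k : ℝ) / (ℓ : ℝ) ≤ d) :
    k ≤ ℓ * d := by
  rw [div_le_iff₀ (by exact_mod_cast hℓ), mul_comm] at h
  exact_mod_cast h

theorem mainTheorem2 (k ℓ : ℕ) (hℓ : 1 ≤ ℓ) :
    (∀ {V W : Type*} [Fintype V] [Nonempty V] [Fintype W] (D : Digraph V) (T : Digraph W),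
      D.IsLoopless →
      T.IsAntidirectedTree →
      T.numArcs = k →
      max ((k : ℝ) / (ℓ : ℝ)) (T.maxDeg : ℝ) ≤ (D.minPseudoSemidegree : ℝ) →
      D.NonDirectedCycleFree (2 * ℓ) →
      D.Contains T) ∧
    (∀ {V W : Type*} [Fintype V] [Nonempty V] [Fintype W] (G : SimpleGraph V) (T : SimpleGraph W)
      [DecidableRel G.Adj] [DecidableRel T.Adj],
      T.IsTree →
      T.edgeSet.ncard ≤ k →
      max ((k : ℝ) / (ℓ : ℝ)) (T.maxDegree : ℝ) ≤ (G.minDegree : ℝ) →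
      2 * (ℓ : ℕ∞) + 1 ≤ G.egirth →
      SimpleGraph.IsContained T G) := by
  refine ⟨?_, ?_⟩
  · intro V W _ _ _ D T hloop hT hk hmax hD
    exact Digraph.contains_of_minPseudoSemidegree hℓ hloop hT
      (hk.le.trans (Nat.le_mul_of_div_le_cast hℓ ((le_max_left _ _).trans hmax)))
      (by exact_mod_cast (le_max_right _ _).trans hmax) hD
  · intro V W _ _ _ G T _ _ hT hk hmax hG
    exact hT.isContained_of_lt_egirth hℓ
      (hk.trans (Nat.le_mul_of_div_le_cast hℓ ((le_max_left _ _).trans hmax)))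
      (by exact_mod_cast (le_max_right _ _).trans hmax) hG
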